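/- Let $\mathcal{X}$ be a homogeneous (finite-dimensional, connected, smooth, boundaryless) Riemannian manifold with Riemannian distance $d$, and let $G=\mathrm{Iso}(\mathcal{X})$ be the group of surjective maps $g:\mathcal{X}\to\mathcal{X}$ with $d(g(x),g(y))=d(x,y)$ for all $x,y$; homogeneous means that $G$ acts transitively on $\mathcal{X}$. Give $\mathrm{Iso}(\mathcal{X})$ the compact-open topology, with subbase $\{g: g(K)\subset U\}$, $K\subset\mathcal{X}$ compact, $U\subset\mathcal{X}$ open. For a Borel probability measure $P$ on $\mathcal{X}$ let $(gP)(A)=P(g^{-1}(A))$. Let $\{P_\theta:\theta\in\Theta\}$ be a family of Borel probability measures on $\mathcal{X}$ that is identifiable ($\theta\mapsto P_\theta$ is injective) and $G$-invariant (for all $g\in G$, $\theta\in\Theta$ the measure $gP_\theta$ belongs to the family), and let $G$ act on $\Theta$ by $P_{g\theta}=gP_\theta$. Then: 1. for every $\theta_0\in\Theta$ the isotropy group $G_{\theta_0}=\{g\in G: g\theta_0=\theta_0\}$ is compact; 2. for every $n$, the image of $G$ in $\mathrm{Iso}(\mathcal{X}^n)$ under $g\mapsto g\times\cdots\times g$ is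 closed in $\mathrm{Iso}(\mathcal{X}^n)$, where $\mathcal{X}^n$ carries the product Riemannian distance $\left(\sum_{i=1}^n d(x_i,y_i)^2\right)^{1/2}$ and $\mathrm{Iso}(\mathcal{X}^n)$ its compact-open topology. -/

import Mathlib

open MeasureTheory Set Bundle
open scoped Manifold ContDiff

/-- The compact-open topology on the set of isometries from `X` onto `Y`, that is, the topology
induced by the compact-open topology of `C(X, Y)`. -/
instance IsometryEquiv.compactOpen {X Y : Type*} [PseudoEMetricSpace X] [PseudoEMetricSpace Y] :
    TopologicalSpace (X ≃ᵢ Y) :=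
  TopologicalSpace.induced (fun g : X ≃ᵢ Y => (⟨g, g.continuous⟩ : C(X, Y)))
    ContinuousMap.compactOpen

/-- The sets `{g | g(K) ⊆ U}`, with `K` compact and `U` open, are a subbase of the topology. -/
theorem IsometryEquiv.compactOpen_eq_generateFrom {X Y : Type*}
    [PseudoEMetricSpace X] [PseudoEMetricSpace Y] :
    (IsometryEquiv.compactOpen : TopologicalSpace (X ≃ᵢ Y)) =
      TopologicalSpace.generateFrom
        {V | ∃ K : Set X, IsCompact K ∧ ∃ U : Set Y, IsOpen U ∧
          V = {g : X ≃ᵢ Y | MapsTo g K U}} := by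
  unfold IsometryEquiv.compactOpen
  rw [ContinuousMap.compactOpen_eq, induced_generateFrom_eq]
  congr 1
  ext V
  constructor
  · rintro ⟨_, ⟨K, hK, U, hU, rfl⟩, rfl⟩
    exact ⟨K, hK, U, hU, rfl⟩
  · rintro ⟨K, hK, U, hU, rfl⟩
    exact ⟨_, ⟨K, hK, U, hU, rfl⟩, rfl⟩

/-- The law `gP`, given by `(gP)(A) = P(g⁻¹(A))`. -/
noncomputable def isometryPush {X : Type*} [MetricSpace X] [MeasurableSpace X] [BorelSpace X]
    (g : X ≃ᵢ X) (P : ProbabilityMeasure X) : ProbabilityMeasure X :=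
  P.map g.continuous.measurable.aemeasurable

theorem isometryPush_one {X : Type*} [MetricSpace X] [MeasurableSpace X] [BorelSpace X]
    (P : ProbabilityMeasure X) : isometryPush (1 : X ≃ᵢ X) P = P :=
  Subtype.ext (Measure.map_id (μ := (P : Measure X)))

theorem isometryPush_mul {X : Type*} [MetricSpace X] [MeasurableSpace X] [BorelSpace X]
    (g h : X ≃ᵢ X) (P : ProbabilityMeasure X) :
    isometryPush (g * h) P = isometryPush g (isometryPush h P) :=
  Subtype.ext (Measure.map_map (μ := (P : Measure X)) g.continuous.measurable
    h.continuous.measurable).symm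

/-- The family `(P θ)` is invariant under all isometries of `X`. -/
def IsInvariantFamily {X Θ : Type*} [MetricSpace X] [MeasurableSpace X] [BorelSpace X]
    (P : Θ → ProbabilityMeasure X) : Prop :=
  ∀ (g : X ≃ᵢ X) (θ : Θ), ∃ θ' : Θ, P θ' = isometryPush g (P θ)

/-- The action of `Iso(X)` on the parameter space of an identifiable invariant family:
`gθ` is the unique parameter with `P (gθ) = g (P θ)`. -/
noncomputable abbrev parameterAction {X Θ : Type*} [MetricSpace X] [MeasurableSpace X]
    [BorelSpace X] (P : Θ → ProbabilityMeasure X) (hid : Function.Injective P)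
    (hinv : IsInvariantFamily P) : MulAction (X ≃ᵢ X) Θ where
  smul g θ := (hinv g θ).choose
  one_smul θ := hid (((hinv 1 θ).choose_spec).trans (isometryPush_one (P θ)))
  mul_smul g h θ := hid (by
    refine ((hinv (g * h) θ).choose_spec).trans ?_
    refine Eq.trans ?_ ((hinv g (hinv h θ).choose).choose_spec).symm
    rw [(hinv h θ).choose_spec, isometryPush_mul])

/-- The isotropy group `{g | gθ₀ = θ₀}` of a parameter `θ₀`. -/
noncomputable def parameterIsotropy {X Θ : Type*} [MetricSpace X] [MeasurableSpace X]
    [BorelSpace X] (P : Θ → ProbabilityMeasure X) (hid : Function.Injective P)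
    (hinv : IsInvariantFamily P) (θ₀ : Θ) : Subgroup (X ≃ᵢ X) :=
  letI := parameterAction P hid hinv
  MulAction.stabilizer (X ≃ᵢ X) θ₀

/-- The isometry `g × ⋯ × g` of `Xⁿ`, where `Xⁿ` carries the product metric
`d(x, y)² = ∑ i, d(x i, y i)²` (the distance of the product Riemannian metric). -/
def diagonalIsometry {X : Type*} [MetricSpace X] (n : ℕ) (g : X ≃ᵢ X) :
    PiLp 2 (fun _ : Fin n => X) ≃ᵢ PiLp 2 (fun _ : Fin n => X) where
  toFun x := WithLp.toLp 2 (fun i => g (x i))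
  invFun x := WithLp.toLp 2 (fun i => g.symm (x i))
  left_inv x := by ext i; simp
  right_inv x := by ext i; simp
  isometry_toFun x y := by
    simp [PiLp.edist_eq_sum (p := 2) (by norm_num), g.isometry.edist_eq]

/-- The diagonal homomorphism `g ↦ g × ⋯ × g` from `Iso(X)` to `Iso(Xⁿ)`. -/
def diagonalHom (X : Type*) [MetricSpace X] (n : ℕ) :
    (X ≃ᵢ X) →* (PiLp 2 (fun _ : Fin n => X) ≃ᵢ PiLp 2 (fun _ : Fin n => X)) where
  toFun := diagonalIsometry n
  map_one' := rfl
  map_mul' _ _ := rfl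

/-! Everything rests on properness of the manifold. Homogeneity gives all points a compact ball of
one common radius, and the length structure lets compactness of balls spread by a fixed amount at a
time (`properSpace_of_homogeneous`). By Arzelà–Ascoli, the isometries that move a base point a
bounded distance then form a compact set (`isCompact_setOf_isometryEquiv`). An isotropy group is
closed and, since a law cannot be carried off to infinity, lies in such a set. Diagonal isometries
near a given one of the power also come from such a set, so limits stay diagonal. -/

/-! ### Properness from homogeneity -/

/-- In a Riemannian manifold, any two points have approximate intermediate points at every
prescribed distance from the first one. -/
theorem exists_dist_eq_dist_lt_of_isRiemannianManifold
    {E : Type*} [NormedAddCommGroup E] [NormedSpace ℝ E]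
    {H : Type*} [TopologicalSpace H] (I : ModelWithCorners ℝ E H)
    {X : Type*} [MetricSpace X] [ChartedSpace H X] [IsManifold I ∞ X]
    [RiemannianBundle (fun x : X => TangentSpace I x)]
    [IsContMDiffRiemannianBundle I ∞ E (fun x : X => TangentSpace I x)]
    [IsRiemannianManifold I X]
    (x y : X) {a ε : ℝ} (ha : 0 ≤ a) (hay : a ≤ dist x y) (hε : 0 < ε) :
    ∃ z : X, dist x z = a ∧ dist z y < dist x y - a + ε := by
  have hlt : Manifold.riemannianEDist I x y < ENNReal.ofReal (dist x y + ε) := by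
    rw [← IsRiemannianManifold.out (I := I) x y, edist_dist]
    exact (ENNReal.ofReal_lt_ofReal_iff (by positivity)).2 (by linarith)
  obtain ⟨γ, h0, h1, hγ, hlen, -, -⟩ :=
    Manifold.exists_lt_locally_constant_of_riemannianEDist_lt hlt zero_lt_one
  have hcont : Continuous fun t => dist x (γ t) := continuous_const.dist hγ.continuous
  obtain ⟨t, ht, hta⟩ : a ∈ (fun t => dist x (γ t)) '' Icc 0 1 :=
    intermediate_value_Icc zero_le_one hcont.continuousOn (by simpa [h0, h1] using ⟨ha, hay⟩)
  have hxz : edist x (γ t) ≤ Manifold.pathELength I γ 0 t := by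
    rw [IsRiemannianManifold.out (I := I)]
    exact Manifold.riemannianEDist_le_pathELength hγ.contMDiffOn h0 rfl ht.1
  have hzy : edist (γ t) y ≤ Manifold.pathELength I γ t 1 := by
    rw [IsRiemannianManifold.out (I := I)]
    exact Manifold.riemannianEDist_le_pathELength hγ.contMDiffOn rfl h1 ht.2
  have hsum : edist x (γ t) + edist (γ t) y < ENNReal.ofReal (dist x y + ε) :=
    (add_le_add hxz hzy).trans_lt (by rwa [Manifold.pathELength_add ht.1 ht.2])
  rw [edist_dist, edist_dist, ← ENNReal.ofReal_add dist_nonneg dist_nonneg,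
    ENNReal.ofReal_lt_ofReal_iff (by positivity)] at hsum
  refine ⟨γ t, hta, ?_⟩
  simp only at hta
  linarith

/-- A homogeneous locally compact length space is proper. -/
theorem properSpace_of_homogeneous {X : Type*} [MetricSpace X] [LocallyCompactSpace X]
    (hhom : ∀ x y : X, ∃ g : X ≃ᵢ X, g x = y)
    (hlen : ∀ (x y : X) {a ε : ℝ}, 0 ≤ a → a ≤ dist x y → 0 < ε →
      ∃ z : X, dist x z = a ∧ dist z y < dist x y - a + ε) : ProperSpace X := by
  rcases isEmpty_or_nonempty X with hX | ⟨⟨x₀⟩⟩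
  · exact ⟨fun x => hX.elim x⟩
  obtain ⟨r, hr, hr₀⟩ : ∃ r > 0, IsCompact (Metric.closedBall x₀ r) := by
    obtain ⟨K, hK, hKx⟩ := exists_compact_mem_nhds x₀
    obtain ⟨r, hr, hrK⟩ := Metric.nhds_basis_closedBall.mem_iff.1 hKx
    exact ⟨r, hr, hK.of_isClosed_subset Metric.isClosed_closedBall hrK⟩
  have hball : ∀ x : X, IsCompact (Metric.closedBall x r) := fun x => by
    obtain ⟨g, rfl⟩ := hhom x₀ x
    rw [← g.image_closedBall]
    exact hr₀.image g.continuous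
  have step : ∀ (x : X) (R : ℝ), 0 ≤ R → IsCompact (Metric.closedBall x R) →
      IsCompact (Metric.closedBall x (R + r / 4)) := by
    intro x R hR hK
    -- Points of the larger ball lie within `r / 4 + r / 4` of the smaller one, hence within `r` of
    -- a centre of a finite `r / 2`-cover.
    obtain ⟨t, -, htf, hcov⟩ := hK.finite_cover_balls (half_pos hr)
    refine (htf.isCompact_biUnion fun c _ => hball c).of_isClosed_subset
      Metric.isClosed_closedBall fun y hy => ?_
    rw [Metric.mem_closedBall, dist_comm] at hy
    obtain ⟨z, hz, hzy⟩ : ∃ z, dist x z ≤ R ∧ dist z y < r / 2 := by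
      rcases le_total (dist x y) R with h | h
      · exact ⟨y, h, by simpa using half_pos hr⟩
      · obtain ⟨z, hz, hzy⟩ := hlen x y hR h (show 0 < r / 4 by positivity)
        exact ⟨z, hz.le, by linarith⟩
    have hzK : z ∈ Metric.closedBall x R := by rwa [Metric.mem_closedBall, dist_comm]
    obtain ⟨c, hc, hzc⟩ := mem_iUnion₂.1 (hcov hzK)
    refine mem_iUnion₂.2 ⟨c, hc, ?_⟩
    rw [Metric.mem_ball] at hzc
    rw [Metric.mem_closedBall]
    have := dist_triangle y z c
    rw [dist_comm y z] at this
    linarith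
  have hnat : ∀ (x : X) (n : ℕ), IsCompact (Metric.closedBall x (n * (r / 4))) := by
    intro x n
    induction n with
    | zero => simp
    | succ n ih =>
      have := step x _ (by positivity) ih
      rwa [Nat.cast_succ, add_one_mul]
  refine ⟨fun x R => ?_⟩
  obtain ⟨n, hn⟩ := exists_nat_ge (R / (r / 4))
  exact (hnat x n).of_isClosed_subset Metric.isClosed_closedBall
    (Metric.closedBall_subset_closedBall ((div_le_iff₀ (by positivity)).1 hn))

/-! ### Compactness in the isometry group -/

namespace IsometryEquiv

/-- The continuous map underlying an isometry. -/
def toC {X Y : Type*} [PseudoEMetricSpace X] [PseudoEMetricSpace Y] (g : X ≃ᵢ Y) : C(X, Y) :=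
  ⟨g, g.continuous⟩

theorem isInducing_toC {X Y : Type*} [PseudoEMetricSpace X] [PseudoEMetricSpace Y] :
    Topology.IsInducing (toC : (X ≃ᵢ Y) → C(X, Y)) :=
  ⟨rfl⟩

theorem toC_injective {X Y : Type*} [PseudoEMetricSpace X] [PseudoEMetricSpace Y] :
    Function.Injective (toC : (X ≃ᵢ Y) → C(X, Y)) := fun _ _ h =>
  IsometryEquiv.ext fun x => DFunLike.congr_fun h x

theorem t2Space {X Y : Type*} [PseudoEMetricSpace X] [EMetricSpace Y] : T2Space (X ≃ᵢ Y) :=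
  .of_injective_continuous toC_injective isInducing_toC.continuous

theorem continuous_apply {X Y : Type*} [PseudoEMetricSpace X] [PseudoEMetricSpace Y] (x : X) :
    Continuous fun g : X ≃ᵢ Y => g x :=
  (ContinuousEvalConst.continuous_eval_const (F := C(X, Y)) x).comp isInducing_toC.continuous

theorem continuous_uncurry {X Y : Type*} [PseudoEMetricSpace X] [LocallyCompactSpace X]
    [PseudoEMetricSpace Y] : Continuous fun p : (X ≃ᵢ Y) × X => p.1 p.2 :=
  (ContinuousEval.continuous_eval (F := C(X, Y))).comp
    (isInducing_toC.continuous.prodMap continuous_id)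

end IsometryEquiv

/-- In a proper space, the isometric self-maps moving a base point by a bounded amount form a
compact set for the compact-open topology. -/
theorem isCompact_setOf_isometry {X : Type*} [MetricSpace X] [ProperSpace X] (x₀ : X) (R : ℝ) :
    IsCompact {f : C(X, X) | Isometry f ∧ dist (f x₀) x₀ ≤ R} := by
  refine ArzelaAscoli.isCompact_of_equicontinuous _ ?_ ?_
  · have hsub : ContinuousMap.toFun '' {f : C(X, X) | Isometry f ∧ dist (f x₀) x₀ ≤ R} =
        {f : X → X | (∀ x y, dist (f x) (f y) = dist x y) ∧ dist (f x₀) x₀ ≤ R} := by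
      ext f
      constructor
      · rintro ⟨f, ⟨hf, hR⟩, rfl⟩
        exact ⟨hf.dist_eq, hR⟩
      · rintro ⟨hf, hR⟩
        have hf' : Isometry f := Isometry.of_dist_eq hf
        exact ⟨⟨f, hf'.continuous⟩, ⟨hf', hR⟩, rfl⟩
    rw [hsub]
    -- Preserving distances is a pointwise closed condition, so Tychonoff applies.
    refine (isCompact_univ_pi fun x =>
      isCompact_closedBall x₀ (dist x x₀ + R)).of_isClosed_subset ?_ ?_
    · simp only [ofPred_and, ofPred_forall]
      refine (isClosed_iInter fun x => isClosed_iInter fun y => ?_).inter ?_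
      · exact isClosed_eq ((continuous_apply x).dist (continuous_apply y)) continuous_const
      · exact isClosed_le ((continuous_apply x₀).dist continuous_const) continuous_const
    · rintro f ⟨hf, hR⟩ x -
      have := dist_triangle (f x) (f x₀) x₀
      rw [hf] at this
      exact this.trans (by linarith)
  · refine (LipschitzWith.uniformEquicontinuous _ 1 fun f => ?_).equicontinuous
    exact f.2.1.lipschitz

/-- In a proper space, the isometries moving a base point by a bounded amount form a compact set
for the compact-open topology. -/
theorem isCompact_setOf_isometryEquiv {X : Type*} [MetricSpace X] [ProperSpace X]
    (x₀ : X) (R : ℝ) : IsCompact {g : X ≃ᵢ X | dist (g x₀) x₀ ≤ R} := by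
  set S : Set C(X, X) := {f | Isometry f ∧ dist (f x₀) x₀ ≤ R}
  have hS : IsCompact S := isCompact_setOf_isometry x₀ R
  rw [IsometryEquiv.isInducing_toC.isCompact_iff]
  -- A limit of surjective isometries need not obviously be surjective. Keeping the inverse as a
  -- second coordinate makes invertibility a closed condition; the inverse moves `x₀` by the same
  -- distance.
  have hclosed : IsClosed {p : C(X, X) × C(X, X) |
      p.1.comp p.2 = ContinuousMap.id X ∧ p.2.comp p.1 = ContinuousMap.id X} :=
    (isClosed_eq (continuous_fst.compCM continuous_snd) continuous_const).inter
      (isClosed_eq (continuous_snd.compCM continuous_fst) continuous_const)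
  convert ((hS.prod hS).inter_right hclosed).image continuous_fst using 1
  ext f
  constructor
  · rintro ⟨g, hg, rfl⟩
    refine ⟨(g.toC, g.symm.toC), ⟨⟨⟨g.isometry, hg⟩, g.symm.isometry, ?_⟩, ?_, ?_⟩, rfl⟩
    · change dist (g.symm x₀) x₀ ≤ R
      rw [← g.dist_eq, g.apply_symm_apply, dist_comm]
      exact hg
    · ext x; exact g.apply_symm_apply x
    · ext x; exact g.symm_apply_apply x
  · rintro ⟨⟨f, h⟩, ⟨⟨⟨hf, hR⟩, -⟩, hfh, -⟩, rfl⟩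
    exact ⟨IsometryEquiv.mk' f h (fun x => DFunLike.congr_fun hfh x) hf, hR, rfl⟩

/-! ### Isotropy groups -/

/-- In a proper space, the isometries preserving a probability measure form a closed set. -/
theorem isClosed_setOf_isometryPush_eq {X : Type*} [MetricSpace X] [ProperSpace X]
    [MeasurableSpace X] [BorelSpace X] (Q : ProbabilityMeasure X) :
    IsClosed {g : X ≃ᵢ X | isometryPush g Q = Q} := by
  have hset : {g : X ≃ᵢ X | isometryPush g Q = Q} = ⋂ f : BoundedContinuousFunction X ℝ,
      {g : X ≃ᵢ X | ∫ x, f (g x) ∂(Q : Measure X) = ∫ x, f x ∂(Q : Measure X)} := by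
    ext g
    have hmap : ∀ f : BoundedContinuousFunction X ℝ,
        ∫ x, f x ∂(isometryPush g Q : Measure X) = ∫ x, f (g x) ∂(Q : Measure X) := fun f =>
      integral_map g.continuous.measurable.aemeasurable f.continuous.aestronglyMeasurable
    simp only [mem_ofPred_eq, mem_iInter, ← hmap]
    refine ⟨fun h f => by rw [h], fun h => Subtype.ext (?_ : (isometryPush g Q : Measure X) = (Q : Measure X))⟩
    exact ext_of_forall_integral_eq_of_IsFiniteMeasure h
  rw [hset]
  refine isClosed_iInter fun f => isClosed_eq ?_ continuous_const
  -- Dominated convergence needs countably generated neighbourhood filters.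
  have : FirstCountableTopology (X ≃ᵢ X) :=
    IsometryEquiv.isInducing_toC.firstCountableTopology
  refine continuous_of_dominated (bound := fun _ => ‖f‖) (fun g => ?_) (fun g => ?_)
    (integrable_const _) (.of_forall fun x => ?_)
  · exact (f.continuous.comp g.continuous).aestronglyMeasurable
  · exact .of_forall fun x => f.norm_coe_le_norm _
  · exact f.continuous.comp (IsometryEquiv.continuous_apply x)

/-- In a proper space, the isometries preserving a probability measure form a compact set. -/
theorem isCompact_setOf_isometryPush_eq {X : Type*} [MetricSpace X] [ProperSpace X]
    [MeasurableSpace X] [BorelSpace X] (Q : ProbabilityMeasure X) :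
    IsCompact {g : X ≃ᵢ X | isometryPush g Q = Q} := by
  obtain ⟨x₀⟩ : Nonempty X := Q.nonempty
  -- A ball of mass above one half must meet its preimage under `g`, which has the same mass.
  obtain ⟨R, hR⟩ : ∃ R : ℝ, 2⁻¹ < (Q : Measure X) (Metric.closedBall x₀ R) := by
    have hmono : Monotone fun n : ℕ => Metric.closedBall x₀ (n : ℝ) := fun m n h =>
      Metric.closedBall_subset_closedBall (Nat.cast_le.2 h)
    have hlim := tendsto_measure_iUnion_atTop (μ := (Q : Measure X)) hmono
    rw [Metric.iUnion_closedBall_nat, measure_univ] at hlim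
    obtain ⟨n, hn⟩ := (hlim.eventually_const_lt ENNReal.one_half_lt_one).exists
    exact ⟨n, hn⟩
  refine (isCompact_setOf_isometryEquiv x₀ (R + R)).of_isClosed_subset
    (isClosed_setOf_isometryPush_eq Q) fun g hg => ?_
  have hB : MeasurableSet (Metric.closedBall x₀ R) := measurableSet_closedBall
  have hpre : 2⁻¹ < (Q : Measure X) (g ⁻¹' Metric.closedBall x₀ R) := by
    rw [← Measure.map_apply g.continuous.measurable hB]
    have : (Q : Measure X).map g = Q := congrArg Subtype.val hg
    rwa [this]
  obtain ⟨x, hx, hgx⟩ : (Metric.closedBall x₀ R ∩ g ⁻¹' Metric.closedBall x₀ R).Nonempty := by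
    refine nonempty_inter_of_measure_lt_add (Q : Measure X)
      (g.continuous.measurable hB) (subset_univ _) (subset_univ _) ?_
    rw [measure_univ, ← ENNReal.inv_two_add_inv_two]
    exact ENNReal.add_lt_add hR hpre
  calc dist (g x₀) x₀ ≤ dist (g x₀) (g x) + dist (g x) x₀ := dist_triangle _ _ _
    _ ≤ R + R := by
      rw [g.dist_eq, dist_comm x₀ x]
      exact add_le_add hx hgx

theorem mem_parameterIsotropy_iff {X Θ : Type*} [MetricSpace X] [MeasurableSpace X]
    [BorelSpace X] (P : Θ → ProbabilityMeasure X) (hid : Function.Injective P)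
    (hinv : IsInvariantFamily P) (θ₀ : Θ) (g : X ≃ᵢ X) :
    g ∈ parameterIsotropy P hid hinv θ₀ ↔ isometryPush g (P θ₀) = P θ₀ := by
  rw [← (hinv g θ₀).choose_spec, hid.eq_iff]
  rfl

/-! ### Diagonal isometries -/

theorem continuous_diagonalHom {X : Type*} [MetricSpace X] [LocallyCompactSpace X] (n : ℕ) :
    Continuous (diagonalHom X n) := by
  refine IsometryEquiv.isInducing_toC.continuous_iff.2
    (ContinuousMap.continuous_of_continuous_uncurry _ ?_)
  refine (PiLp.continuous_toLp 2 _).comp (continuous_pi fun i => ?_)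
  exact IsometryEquiv.continuous_uncurry.comp
    (continuous_fst.prodMk ((PiLp.continuous_apply 2 _ i).comp continuous_snd))

/-- For a proper space, the group of diagonal isometries of a power is closed. -/
theorem isClosed_range_diagonalHom (X : Type*) [MetricSpace X] [ProperSpace X] (n : ℕ) :
    IsClosed ((diagonalHom X n).range :
      Set (PiLp 2 (fun _ : Fin n => X) ≃ᵢ PiLp 2 (fun _ : Fin n => X))) := by
  have : T2Space (PiLp 2 (fun _ : Fin n => X) ≃ᵢ PiLp 2 (fun _ : Fin n => X)) :=
    IsometryEquiv.t2Space
  -- Without a coordinate or a point, nothing controls `g`, but the power is trivial.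
  rcases isEmpty_or_nonempty (Fin n × X) with h | ⟨⟨i, x₀⟩⟩
  · have : Subsingleton (PiLp 2 (fun _ : Fin n => X)) :=
      ⟨fun x y => by ext i; exact h.elim (i, x i)⟩
    have : Subsingleton (PiLp 2 (fun _ : Fin n => X) ≃ᵢ PiLp 2 (fun _ : Fin n => X)) :=
      ⟨fun f g => IsometryEquiv.ext fun x => Subsingleton.elim _ _⟩
    exact (Set.subsingleton_of_subsingleton).isClosed
  refine isClosed_of_closure_subset fun φ hφ => ?_
  let p : PiLp 2 (fun _ : Fin n => X) := WithLp.toLp 2 fun _ => x₀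
  let U : Set (PiLp 2 (fun _ : Fin n => X) ≃ᵢ PiLp 2 (fun _ : Fin n => X)) :=
    {ψ | dist (ψ p i) (φ p i) < 1}
  have hU : IsOpen U := isOpen_lt
    (((PiLp.continuous_apply 2 _ i).comp (IsometryEquiv.continuous_apply p)).dist
      continuous_const) continuous_const
  let C : Set (X ≃ᵢ X) := {g | dist (g x₀) x₀ ≤ 1 + dist (φ p i) x₀}
  have hC : IsClosed (diagonalHom X n '' C) :=
    ((isCompact_setOf_isometryEquiv x₀ _).image (continuous_diagonalHom n)).isClosed
  have hsub : U ∩ (diagonalHom X n).range ⊆ diagonalHom X n '' C := by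
    rintro _ ⟨hg, g, rfl⟩
    refine ⟨g, ?_, rfl⟩
    have hg' : dist (g x₀) (φ p i) < 1 := hg
    exact (dist_triangle _ (φ p i) _).trans (by linarith)
  have hφU : φ ∈ closure (U ∩ (diagonalHom X n).range) :=
    hU.inter_closure ⟨by simp [U], hφ⟩
  obtain ⟨g, -, hg⟩ := closure_minimal hsub hC hφU
  exact ⟨g, hg⟩

theorem lemma3
    {E : Type*} [NormedAddCommGroup E] [NormedSpace ℝ E] [FiniteDimensional ℝ E]
    {H : Type*} [TopologicalSpace H] (I : ModelWithCorners ℝ E H)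
    -- `X` is a smooth Riemannian manifold with its Riemannian distance
    -- (connected, as the distance is finite)
    {X : Type*} [MetricSpace X] [ChartedSpace H X] [IsManifold I ∞ X] [BoundarylessManifold I X]
    [RiemannianBundle (fun x : X => TangentSpace I x)]
    [IsContMDiffRiemannianBundle I ∞ E (fun x : X => TangentSpace I x)]
    [IsRiemannianManifold I X]
    [MeasurableSpace X] [BorelSpace X]
    -- `X` is homogeneous
    (hhom : ∀ x y : X, ∃ g : X ≃ᵢ X, g x = y)
    -- an identifiable and invariant family of distributions on `X`
    {Θ : Type*} (P : Θ → ProbabilityMeasure X) (hid : Function.Injective P)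
    (hinv : IsInvariantFamily P) :
    (∀ θ₀ : Θ, IsCompact (parameterIsotropy P hid hinv θ₀ : Set (X ≃ᵢ X))) ∧
      ∀ n : ℕ, IsClosed ((diagonalHom X n).range :
        Set (PiLp 2 (fun _ : Fin n => X) ≃ᵢ PiLp 2 (fun _ : Fin n => X))) := by
  have := Manifold.locallyCompact_of_finiteDimensional I (M := X)
  have : ProperSpace X := properSpace_of_homogeneous hhom
    (exists_dist_eq_dist_lt_of_isRiemannianManifold I)
  refine ⟨fun θ₀ => ?_, isClosed_range_diagonalHom X⟩
  convert isCompact_setOf_isometryPush_eq (P θ₀) using 1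
  ext g
  exact mem_parameterIsotropy_iff P hid hinv θ₀ g
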